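/- Let $\eta_1,\eta_2,\dots$ be independent, identically distributed real random variables with distribution function $F(y)=\mathbf P(\eta_1\le y)$ and tail $\overline F=1-F$. Under $\mathbf P_x$ let $R$ be the random exchange chain $R_0=x$, $R_n=\max\{R_{n-1}-1,\eta_n\}$, $n\ge1$, and for $x_0\in\mathbb R$ put $T^{(R)}_{x_0}=\inf\{n\ge1: R_n\le x_0\}$ (with $\inf\emptyset=\infty$). Assume that $x_0$ satisfies $\mathbf P(\eta_1\le x_0)\,\mathbf P(\eta_1>x_0)>0$, that $\mathbf E\eta_1<\infty$ (i.e. $\mathbf E\eta_1^+<\infty$), and that $F$ belongs to the class $\mathcal S^*$ of strong subexponential distributions: $\mu_+=\int_0^\infty\overline F(y)\,dy<\infty$, $\overline F(y)>0$ for all $y$, and $$\frac{\int_0^x\overline F(x-y)\overline F(y)\,dy}{\overline F(x)}\to 2\mu_+\quad\text{as }x\to\infty.$$ Then, for every $x>x_0$, the expectation $\mathbf E_x[T^{(R)}_{x_0}]$ is finite and $$\mathbf P_x(T^{(R)}_{x_0}>n)\sim \mathbf E_x[T^{(R)}_{x_0}]\,\mathbf P(\eta_1>n),\quad n\to\infty.$$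 Moreover, the product $\prod_{k=0}^\infty\mathbf P(\eta_1\le x_0+k)$ converges to a positive number, and for every integer $n\ge0$ and every $x\in(x_0+n,x_0+n+1]$, $$\mathbf E_x[T^{(R)}_{x_0}]=\frac{1}{\prod_{k=0}^{\infty}\mathbf P(\eta_1\le x_0+k)}\left(1+\sum_{j=1}^{n}\prod_{k=0}^{j-1}\mathbf P(\eta_1\le x_0+k)\right).$$ -/

import Mathlib

open MeasureTheory ProbabilityTheory Filter Topology Asymptotics
open scoped ENNReal

namespace RandomExchange

/-- The random exchange chain started at `x`: `R₀ = x` and `R_{n+1} = max (R_n - 1) η_{n+1}`.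
The innovations `η₁, η₂, …` are indexed from `0`: `η n` is the innovation used in step `n + 1`. -/
def chain {Ω : Type*} (η : ℕ → Ω → ℝ) (x : ℝ) : ℕ → Ω → ℝ
  | 0, _ => x
  | n + 1, ω => max (chain η x n ω - 1) (η n ω)

/-- The recurrence time `inf {n ≥ 1 : R_n ≤ x₀}` of the chain started at `x`, with `inf ∅ = ∞`. -/
noncomputable def recTime {Ω : Type*} (η : ℕ → Ω → ℝ) (x₀ x : ℝ) (ω : Ω) : ℕ∞ :=
  ⨅ (n : ℕ) (_ : 1 ≤ n ∧ chain η x n ω ≤ x₀), (n : ℕ∞)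

/-- The expectation, in `[0, ∞]`, of the recurrence time of the chain started at `x`. -/
noncomputable def meanRecTime {Ω : Type*} [MeasurableSpace Ω] (P : Measure Ω)
    (η : ℕ → Ω → ℝ) (x₀ x : ℝ) : ℝ≥0∞ :=
  ∫⁻ ω, (recTime η x₀ x ω : ℝ≥0∞) ∂P

/-- The tail `y ↦ μ (y, ∞)` of a distribution `μ` on the line. -/
noncomputable def tail (μ : Measure ℝ) (y : ℝ) : ℝ := μ.real (Set.Ioi y)

/-- The class `S*` of strong subexponential distributions. -/
structure StrongSubexponential (μ : Measure ℝ) : Prop where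
  integrableOn_tail : IntegrableOn (tail μ) (Set.Ioi 0)
  tail_pos : ∀ y, 0 < tail μ y
  tendsto_conv : Tendsto (fun x => (∫ y in (0 : ℝ)..x, tail μ (x - y) * tail μ y) / tail μ x)
    atTop (𝓝 (2 * ∫ y in Set.Ioi (0 : ℝ), tail μ y))

end RandomExchange

/-!
Lower each innovation by the time elapsed since its arrival: the chain at time `n` is the maximum of
`x - n` and of the lowered innovations. Call `n` a renewal epoch if all the lowered innovations are
`≤ x₀` at time `n`. A level that is respected at `n` stays respected afterwards, so from a renewal
epoch on the later epochs depend on the fresh innovations only: the epochs form a renewal process,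
and `n` is an epoch with probability `u n = ∏_{k < n} P(η ≤ x₀ + k)`, which decreases to a limit
`L > 0` because `∑ P(η > x₀ + k) < ∞`. The chain started in `(x₀ + m, x₀ + m + 1]` first recurs at
the first epoch exceeding `m` (`lt_recTime_iff`).

Let `q n` be the probability of no epoch in `(0, n]`. Decomposing at the last epoch up to time `n`
(`measureReal_noRenewal`) gives `P(T > n) = ∑_{j ≤ min m n} u j * q (n - j)`, and `∑_{j ≤ n} u j *
q (n - j) = 1`. The latter identity yields `∑ q = 1 / L`, hence the formula for the mean. Taking
differences in it shows that `q (n + 1) = (w * q) n` with `w n = u n * P(η > x₀ + n)`, which is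
asymptotic to `L * P(η > n)`, and `∑ w = 1 - L < 1`.

For the tail, the integer tails of a strong subexponential law form a subexponential sequence
(`StrongSubexponential.subexponentialSeq`), and the solution of a defective renewal equation driven
by `w ~ c f` with `f` subexponential satisfies `q ~ c (∑ q) / (1 - ∑ w) f`
(`SubexponentialSeq.tendsto_renewal`). Here the constant is `1 / L`, the mean gap between epochs.
The finite sum above then transfers the asymptotics from `q` to `P(T > n)`.
-/

open Finset.HasAntidiagonal (antidiagonal mem_antidiagonal)

namespace RandomExchange

/-! ### Renewal equations driven by subexponential sequences -/

/-- A positive sequence `f` that is long-tailed, and such that the terms of `(f * f) n` with both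
indices large are negligible with respect to `f n`. For summable `f` this is the usual condition
`(f * f) n ~ 2 (∑ f) f n`; here it is stated by truncation and without summability. -/
structure SubexponentialSeq (f : ℕ → ℝ) : Prop where
  pos : ∀ n, 0 < f n
  long : Tendsto (fun n => f n / f (n + 1)) atTop (𝓝 1)
  tight : ∀ ε > 0, ∀ᶠ M in atTop, ∀ᶠ n in atTop,
    ∑ ij ∈ antidiagonal n with M < ij.1 ∧ M < ij.2, f ij.1 * f ij.2 ≤ ε * f n

theorem sum_antidiagonal_split (g : ℕ × ℕ → ℝ) {M n : ℕ} (h : 2 * M < n) :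
    ∑ ij ∈ antidiagonal n, g ij =
      ∑ k ∈ Finset.range (M + 1), g (k, n - k) + ∑ k ∈ Finset.range (M + 1), g (n - k, k) +
        ∑ ij ∈ antidiagonal n with M < ij.1 ∧ M < ij.2, g ij := by
  have h1 : ∑ ij ∈ antidiagonal n with ij.1 ≤ M, g ij =
      ∑ k ∈ Finset.range (M + 1), g (k, n - k) := by
    refine Finset.sum_nbij' (fun ij => ij.1) (fun k => (k, n - k)) ?_ ?_ ?_ ?_ ?_
    · simp only [Finset.mem_filter, mem_antidiagonal, Finset.mem_range]; intros; omega
    · simp only [Finset.mem_filter, mem_antidiagonal, Finset.mem_range]; intros; omega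
    · rintro ⟨i, j⟩ hij
      simp only [Finset.mem_filter, mem_antidiagonal] at hij
      simp [← hij.1]
    · simp
    · rintro ⟨i, j⟩
      simp only [Finset.mem_filter, mem_antidiagonal]
      intro hij
      congr 2
      omega
  have h2 : ∑ ij ∈ antidiagonal n with ij.2 ≤ M, g ij =
      ∑ k ∈ Finset.range (M + 1), g (n - k, k) := by
    refine Finset.sum_nbij' (fun ij => ij.2) (fun k => (n - k, k)) ?_ ?_ ?_ ?_ ?_
    · simp only [Finset.mem_filter, mem_antidiagonal, Finset.mem_range]; intros; omega
    · simp only [Finset.mem_filter, mem_antidiagonal, Finset.mem_range]; intros; omega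
    · rintro ⟨i, j⟩ hij
      simp only [Finset.mem_filter, mem_antidiagonal] at hij
      simp [← hij.1]
    · simp
    · rintro ⟨i, j⟩
      simp only [Finset.mem_filter, mem_antidiagonal]
      intro hij
      congr 2
      omega
  rw [← h1, ← h2, ← Finset.sum_filter_add_sum_filter_not _ (fun ij : ℕ × ℕ => ij.1 ≤ M),
    add_assoc]
  congr 1
  rw [← Finset.sum_filter_add_sum_filter_not (Finset.filter _ _) (fun ij : ℕ × ℕ => ij.2 ≤ M),
    Finset.filter_filter, Finset.filter_filter]
  congr 1
  · refine Finset.sum_congr (Finset.filter_congr ?_) fun _ _ => rfl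
    simp only [mem_antidiagonal]; intros; omega
  · refine Finset.sum_congr (Finset.filter_congr ?_) fun _ _ => rfl
    simp only [mem_antidiagonal]; intros; omega

namespace SubexponentialSeq

variable {f : ℕ → ℝ}

theorem tendsto_div_add (hf : SubexponentialSeq f) (k : ℕ) :
    Tendsto (fun n => f n / f (n + k)) atTop (𝓝 1) := by
  induction k with
  | zero => simp [div_self (hf.pos _).ne']
  | succ k ih =>
    have := ih.mul (hf.long.comp (tendsto_add_atTop_nat k))
    rw [one_mul] at this
    refine this.congr fun n => ?_
    have := (hf.pos (n + k)).ne'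
    simp only [Function.comp, ← add_assoc]
    field_simp

theorem tendsto_sub_div_succ (hf : SubexponentialSeq f) {a : ℕ → ℝ} {α : ℝ}
    (ha : Tendsto (fun n => a n / f n) atTop (𝓝 α)) (k : ℕ) :
    Tendsto (fun n => a (n - k) / f (n + 1)) atTop (𝓝 α) := by
  rw [← tendsto_add_atTop_iff_nat k]
  have := ha.mul (hf.tendsto_div_add (k + 1))
  rw [mul_one] at this
  refine this.congr fun n => ?_
  have := (hf.pos n).ne'
  simp only [Nat.add_sub_cancel, ← add_assoc]
  field_simp

/-- A finite part of a convolution: only boundedly many terms of `b` are paired with the far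
terms of `a`. -/
theorem tendsto_sum_sub_div_succ (hf : SubexponentialSeq f) {a : ℕ → ℝ} {α : ℝ}
    (ha : Tendsto (fun n => a n / f n) atTop (𝓝 α)) (b : ℕ → ℝ) (M : ℕ) :
    Tendsto (fun n => (∑ k ∈ Finset.range M, b k * a (n - k)) / f (n + 1)) atTop
      (𝓝 ((∑ k ∈ Finset.range M, b k) * α)) := by
  simp_rw [Finset.sum_div, Finset.sum_mul, mul_div_assoc]
  exact tendsto_finsetSum _ fun k _ => (hf.tendsto_sub_div_succ ha k).const_mul _

theorem tendsto_self_div (hf : SubexponentialSeq f) :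
    Tendsto (fun n => f n / f n) atTop (𝓝 1) := by
  simp [div_self (hf.pos _).ne']

/-- The `tight` condition, with the normalisation `f (n + 1)` instead of `f n`. -/
theorem tight_succ (hf : SubexponentialSeq f) {ε : ℝ} (hε : 0 < ε) :
    ∀ᶠ M in atTop, ∀ᶠ n in atTop,
      ∑ ij ∈ antidiagonal n with M < ij.1 ∧ M < ij.2, f ij.1 * f ij.2 ≤ ε * f (n + 1) := by
  filter_upwards [hf.tight (ε / 2) (half_pos hε)] with M hM
  filter_upwards [hM, hf.long.eventually (gt_mem_nhds one_lt_two)] with n hn h2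
  rw [div_lt_iff₀ (hf.pos _)] at h2
  nlinarith

theorem exists_le_mul_of_tendsto (hf : SubexponentialSeq f) {a : ℕ → ℝ} {α : ℝ}
    (ha : Tendsto (fun n => a n / f n) atTop (𝓝 α)) : ∃ K > 0, ∀ n, a n ≤ K * f n := by
  obtain ⟨K, hK⟩ := ha.bddAbove_range
  refine ⟨max K 1, by positivity, fun n => ?_⟩
  rw [← div_le_iff₀ (hf.pos n)]
  exact (hK ⟨n, rfl⟩).trans (le_max_left _ _)

variable {w q : ℕ → ℝ} {c : ℝ}

/-- The solution of a defective renewal equation driven by `w = O(f)` is itself `O(f)`. -/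
theorem renewal_bounded (hf : SubexponentialSeq f) (hw0 : ∀ n, 0 ≤ w n) (hws : Summable w)
    (hw1 : ∑' n, w n < 1) (hw : Tendsto (fun n => w n / f n) atTop (𝓝 c)) (hq0 : ∀ n, 0 ≤ q n)
    (hq : ∀ n, q (n + 1) = ∑ ij ∈ antidiagonal n, w ij.1 * q ij.2) :
    ∃ C > 0, ∀ n, q n ≤ C * f n := by
  obtain ⟨K, hK0, hK⟩ := hf.exists_le_mul_of_tendsto hw
  set W := ∑' n, w n
  obtain ⟨δ, hδ0, hδ⟩ : ∃ δ > 0, W + 2 * δ < 1 := ⟨(1 - W) / 4, by linarith, by linarith⟩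
  obtain ⟨M, hM⟩ := (hf.tight_succ (div_pos hδ0 hK0)).exists
  have hWM : ∑ k ∈ Finset.range (M + 1), w k ≤ W := hws.sum_le_tsum _ fun i _ => hw0 i
  have t1 := (hf.tendsto_sum_sub_div_succ hf.tendsto_self_div w (M + 1)).eventually
    (gt_mem_nhds (show _ < W + δ by linarith))
  set H := |(∑ k ∈ Finset.range (M + 1), q k) * c| + 1
  have hH : 0 < H := by positivity
  have t2 := (hf.tendsto_sum_sub_div_succ hw q (M + 1)).eventually
    (gt_mem_nhds (show _ < H from (le_abs_self _).trans_lt (lt_add_one _)))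
  obtain ⟨n₀, hn₀⟩ := eventually_atTop.1 (hM.and (t1.and (t2.and (eventually_gt_atTop (2 * M)))))
  set S := ∑ k ∈ Finset.range (n₀ + 1), q k / f k
  have hS : 0 ≤ S := Finset.sum_nonneg fun k _ => div_nonneg (hq0 k) (hf.pos k).le
  -- `S` settles the indices up to `n₀`; beyond `n₀` each step maps a bound `C` to
  -- `(W + 2 δ) C + H`, so that any `C ≥ H / (1 - W - 2 δ)` is preserved.
  set C := S + H / (1 - W - 2 * δ)
  have hd : 0 < 1 - W - 2 * δ := by linarith
  have hHd : 0 < H / (1 - W - 2 * δ) := by positivity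
  have hC : 0 < C := by positivity
  have hCH : H + (W + 2 * δ) * C ≤ C := by
    have : H / (1 - W - 2 * δ) ≤ C := by linarith
    rw [div_le_iff₀ hd] at this
    linarith
  refine ⟨C, hC, fun n => ?_⟩
  induction n using Nat.strong_induction_on with
  | _ n ih =>
    rcases le_or_gt n n₀ with h | h
    · rw [← div_le_iff₀ (hf.pos n)]
      have : q n / f n ≤ S := Finset.single_le_sum
        (f := fun k => q k / f k) (fun k _ => div_nonneg (hq0 k) (hf.pos k).le)
        (Finset.mem_range.2 (Nat.lt_succ_of_le h))
      linarith
    · obtain ⟨n, rfl⟩ : ∃ m, n = m + 1 := ⟨n - 1, by omega⟩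
      obtain ⟨h1, h2, h3, h4⟩ := hn₀ n (by omega)
      have hp := hf.pos (n + 1)
      rw [div_lt_iff₀ hp] at h2 h3
      rw [hq, sum_antidiagonal_split _ h4]
      have e1 : ∑ k ∈ Finset.range (M + 1), w k * q (n - k) ≤
          C * ∑ k ∈ Finset.range (M + 1), w k * f (n - k) := by
        rw [Finset.mul_sum]
        refine Finset.sum_le_sum fun k _ => ?_
        have := mul_le_mul_of_nonneg_left (ih (n - k) (by omega)) (hw0 k)
        linarith
      have e2 : ∑ k ∈ Finset.range (M + 1), w (n - k) * q k =
          ∑ k ∈ Finset.range (M + 1), q k * w (n - k) := by simp_rw [mul_comm]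
      have e3 : ∑ ij ∈ antidiagonal n with M < ij.1 ∧ M < ij.2, w ij.1 * q ij.2 ≤
          K * C * ∑ ij ∈ antidiagonal n with M < ij.1 ∧ M < ij.2, f ij.1 * f ij.2 := by
        rw [Finset.mul_sum]
        refine Finset.sum_le_sum fun ij hij => ?_
        simp only [Finset.mem_filter, mem_antidiagonal] at hij
        have := mul_le_mul (hK ij.1) (ih ij.2 (by omega)) (hq0 _)
          (mul_pos hK0 (hf.pos _)).le
        linarith
      have e4 := mul_le_mul_of_nonneg_left h1 (mul_pos hK0 hC).le
      have e5 : K * C * (δ / K * f (n + 1)) = C * δ * f (n + 1) := by field_simp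
      have e6 := mul_le_mul_of_nonneg_left h2.le hC.le
      have e7 := mul_le_mul_of_nonneg_right hCH hp.le
      simp only [e2]
      nlinarith

/-- One step of the contraction: a bound `D` on the eventual deviation of `q n / f n` from its
prospective limit `L` improves to any number exceeding `D * ∑ w`. -/
theorem renewal_contraction (hf : SubexponentialSeq f) (hw0 : ∀ n, 0 ≤ w n) (hws : Summable w)
    (hw : Tendsto (fun n => w n / f n) atTop (𝓝 c)) (hq0 : ∀ n, 0 ≤ q n) (hqs : Summable q)
    (hq : ∀ n, q (n + 1) = ∑ ij ∈ antidiagonal n, w ij.1 * q ij.2)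
    {C : ℝ} (hC0 : 0 < C) (hC : ∀ n, q n ≤ C * f n) {L : ℝ}
    (hL : L = (∑' n, w n) * L + c * ∑' n, q n) {D E : ℝ} (hD : 0 ≤ D)
    (hDE : (∑' n, w n) * D < E) (h : ∀ᶠ n in atTop, |q n / f n - L| ≤ D) :
    ∀ᶠ n in atTop, |q n / f n - L| ≤ E := by
  obtain ⟨K, hK0, hK⟩ := hf.exists_le_mul_of_tendsto hw
  set W := ∑' n, w n
  set Q := ∑' n, q n
  obtain ⟨δ, hδ0, hδ⟩ : ∃ δ > 0, W * D + 6 * δ < E := ⟨(E - W * D) / 12, by linarith, by linarith⟩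
  have s1 : Tendsto (fun M => |L * ((∑ k ∈ Finset.range (M + 1), w k) - W)|) atTop (𝓝 0) := by
    have := ((hws.hasSum.tendsto_sum_nat.comp (tendsto_add_atTop_nat 1)).sub_const W).const_mul L
    simpa [Function.comp_def, W] using this.abs
  have s2 : Tendsto (fun M => |((∑ k ∈ Finset.range (M + 1), q k) - Q) * c|) atTop (𝓝 0) := by
    have := ((hqs.hasSum.tendsto_sum_nat.comp (tendsto_add_atTop_nat 1)).sub_const Q).mul_const c
    simpa [Function.comp_def, Q] using this.abs
  obtain ⟨M, hM, hM1, hM2⟩ := ((hf.tight_succ (div_pos hδ0 (mul_pos hK0 hC0))).and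
    ((s1.eventually (gt_mem_nhds hδ0)).and (s2.eventually (gt_mem_nhds hδ0)))).exists
  set WM := ∑ k ∈ Finset.range (M + 1), w k
  set QM := ∑ k ∈ Finset.range (M + 1), q k
  have hWM : WM ≤ W := hws.sum_le_tsum _ fun i _ => hw0 i
  have t0 := hf.tendsto_sum_sub_div_succ hf.tendsto_self_div w (M + 1)
  have t1 := (((t0.const_mul D).eventually
    (gt_mem_nhds (show _ < W * D + δ by nlinarith))))
  have t2 : ∀ᶠ n in atTop, |L * ((∑ k ∈ Finset.range (M + 1), w k * f (n - k)) / f (n + 1) - W)|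
      < 2 * δ := by
    have := ((t0.sub_const W).const_mul L).abs
    exact this.eventually (gt_mem_nhds (by rw [mul_one]; linarith))
  have t3 : ∀ᶠ n in atTop, |(∑ k ∈ Finset.range (M + 1), q k * w (n - k)) / f (n + 1) - c * Q|
      < 2 * δ := by
    have := ((hf.tendsto_sum_sub_div_succ hw q (M + 1)).sub_const (c * Q)).abs
    exact this.eventually (gt_mem_nhds (by rw [mul_comm c, ← sub_mul]; linarith))
  rw [eventually_atTop] at h
  obtain ⟨n₁, hn₁⟩ := h
  rw [← map_add_atTop_eq_nat 1, eventually_map]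
  filter_upwards [hM, t1, t2, t3, eventually_gt_atTop (2 * M), eventually_ge_atTop (n₁ + M)]
    with n h1 h2 h3 h4 h5 h6
  have hp := hf.pos (n + 1)
  set mid := ∑ ij ∈ antidiagonal n with M < ij.1 ∧ M < ij.2, w ij.1 * q ij.2
  have hmid0 : 0 ≤ mid := Finset.sum_nonneg fun ij _ => mul_nonneg (hw0 _) (hq0 _)
  have hmid : mid / f (n + 1) ≤ δ := by
    rw [div_le_iff₀ hp]
    calc mid ≤ K * C *
          ∑ ij ∈ antidiagonal n with M < ij.1 ∧ M < ij.2, f ij.1 * f ij.2 := by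
            rw [Finset.mul_sum]
            refine Finset.sum_le_sum fun ij _ => ?_
            have := mul_le_mul (hK ij.1) (hC ij.2) (hq0 _) (mul_pos hK0 (hf.pos _)).le
            linarith
      _ ≤ K * C * (δ / (K * C) * f (n + 1)) := mul_le_mul_of_nonneg_left h1 (by positivity)
      _ = δ * f (n + 1) := by field_simp
  have hfirst : |(∑ k ∈ Finset.range (M + 1), w k * (q (n - k) - L * f (n - k))) / f (n + 1)| ≤
      D * ((∑ k ∈ Finset.range (M + 1), w k * f (n - k)) / f (n + 1)) := by
    rw [abs_div, abs_of_pos hp, ← mul_div_assoc]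
    refine div_le_div_of_nonneg_right ?_ hp.le
    rw [Finset.mul_sum]
    refine (Finset.abs_sum_le_sum_abs _ _).trans (Finset.sum_le_sum fun k hk => ?_)
    rw [Finset.mem_range] at hk
    have hpk := hf.pos (n - k)
    have := hn₁ (n - k) (by omega)
    rw [div_sub' hpk.ne', abs_div, abs_of_pos hpk, div_le_iff₀ hpk] at this
    rw [abs_mul, abs_of_nonneg (hw0 k), mul_comm L]
    have := mul_le_mul_of_nonneg_left this (hw0 k)
    linarith
  -- Splitting `L = W L + c Q` pairs `W L` with the terms carrying small indices of `w`, and `c Q`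
  -- with those carrying small indices of `q`; only the first pairing involves the bound `D`.
  have key : q (n + 1) / f (n + 1) - L =
      (∑ k ∈ Finset.range (M + 1), w k * (q (n - k) - L * f (n - k))) / f (n + 1) +
      L * ((∑ k ∈ Finset.range (M + 1), w k * f (n - k)) / f (n + 1) - W) +
      ((∑ k ∈ Finset.range (M + 1), q k * w (n - k)) / f (n + 1) - c * Q) + mid / f (n + 1) := by
    rw [hq, sum_antidiagonal_split _ h5]
    have e1 : ∑ k ∈ Finset.range (M + 1), w k * (q (n - k) - L * f (n - k)) =
        ∑ k ∈ Finset.range (M + 1), w k * q (n - k) -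
          L * ∑ k ∈ Finset.range (M + 1), w k * f (n - k) := by
      rw [Finset.mul_sum, ← Finset.sum_sub_distrib]
      exact Finset.sum_congr rfl fun k _ => by ring
    have e2 : ∑ k ∈ Finset.range (M + 1), w (n - k) * q k =
        ∑ k ∈ Finset.range (M + 1), q k * w (n - k) := by simp_rw [mul_comm]
    simp only [e1, e2]
    field_simp
    linear_combination (-f (n + 1)) * hL
  rw [key]
  rw [abs_le] at hfirst ⊢
  rw [abs_lt] at h3 h4
  have := div_nonneg hmid0 hp.le
  constructor <;> linarith

/-- **Local asymptotics for a defective renewal equation.** If `w n ~ c f n` with `f`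
subexponential and `∑ w < 1`, the solution `q` of `q (n + 1) = (w * q) n` satisfies
`q n ~ c (∑ q) / (1 - ∑ w) f n`. -/
theorem tendsto_renewal (hf : SubexponentialSeq f) (hw0 : ∀ n, 0 ≤ w n) (hws : Summable w)
    (hw1 : ∑' n, w n < 1) (hw : Tendsto (fun n => w n / f n) atTop (𝓝 c)) (hq0 : ∀ n, 0 ≤ q n)
    (hqs : Summable q) (hq : ∀ n, q (n + 1) = ∑ ij ∈ antidiagonal n, w ij.1 * q ij.2) :
    Tendsto (fun n => q n / f n) atTop (𝓝 (c * (∑' n, q n) / (1 - ∑' n, w n))) := by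
  obtain ⟨C, hC0, hC⟩ := hf.renewal_bounded hw0 hws hw1 hw hq0 hq
  set L := c * (∑' n, q n) / (1 - ∑' n, w n) with hLdef
  have hL : L = (∑' n, w n) * L + c * ∑' n, q n := by
    have : 1 - ∑' n, w n ≠ 0 := by linarith
    rw [hLdef]; field_simp; ring
  have hW0 : 0 ≤ ∑' n, w n := tsum_nonneg hw0
  obtain ⟨θ, hθ, hθ1⟩ := exists_between hw1
  have hD : 0 < C + |L| := by positivity
  have main : ∀ k : ℕ, ∀ᶠ n in atTop, |q n / f n - L| ≤ θ ^ k * (C + |L|) := by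
    intro k
    induction k with
    | zero =>
      refine Eventually.of_forall fun n => ?_
      have h1 : q n / f n ≤ C := (div_le_iff₀ (hf.pos n)).2 (hC n)
      have h2 : 0 ≤ q n / f n := div_nonneg (hq0 n) (hf.pos n).le
      calc _ ≤ |q n / f n| + |L| := abs_sub _ _
        _ ≤ _ := by rw [abs_of_nonneg h2]; linarith
    | succ k ih =>
      have hpos : 0 < θ ^ k * (C + |L|) := mul_pos (pow_pos (hW0.trans_lt hθ) k) hD
      refine hf.renewal_contraction hw0 hws hw hq0 hqs hq hC0 hC hL hpos.le ?_ ih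
      rw [pow_succ']
      nlinarith
  have hlim : Tendsto (fun k : ℕ => θ ^ k * (C + |L|)) atTop (𝓝 0) := by
    simpa using (tendsto_pow_atTop_nhds_zero_of_lt_one (hW0.trans hθ.le) hθ1).mul_const (C + |L|)
  rw [Metric.tendsto_nhds]
  intro ε hε
  obtain ⟨k, hk⟩ := (hlim.eventually (gt_mem_nhds hε)).exists
  filter_upwards [main k] with n hn
  rw [Real.dist_eq]
  exact hn.trans_lt hk

end SubexponentialSeq

/-! ### Strong subexponential tails -/

theorem tail_antitone (μ : Measure ℝ) [IsFiniteMeasure μ] : Antitone (tail μ) :=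
  fun _ _ h => measureReal_mono (Set.Ioi_subset_Ioi h)

theorem tail_nonneg (μ : Measure ℝ) (y : ℝ) : 0 ≤ tail μ y := measureReal_nonneg

theorem intervalIntegrable_tail_mul_tail (μ : Measure ℝ) [IsFiniteMeasure μ] (x a b : ℝ) :
    IntervalIntegrable (fun y => tail μ (x - y) * tail μ y) volume a b := by
  have h1 : Monotone fun y => tail μ (x - y) := fun _ _ h =>
    tail_antitone μ (sub_le_sub_left h x)
  have hb : ∀ᵐ y, ‖tail μ (x - y)‖ ≤ μ.real Set.univ := Eventually.of_forall fun y => by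
    rw [Real.norm_of_nonneg (tail_nonneg _ _)]
    exact measureReal_mono (Set.subset_univ _)
  have h2 := (tail_antitone μ).intervalIntegrable (μ := volume) (a := a) (b := b)
  have h3 := h1.measurable.aestronglyMeasurable (μ := volume)
  exact ⟨h2.1.bdd_mul h3.restrict (ae_restrict_of_ae hb),
    h2.2.bdd_mul h3.restrict (ae_restrict_of_ae hb)⟩

namespace StrongSubexponential

variable {μ : Measure ℝ}

theorem intervalIntegral_add_integral_Ioi (hμ : StrongSubexponential μ) {t : ℝ} (ht : 0 ≤ t) :
    (∫ y in (0 : ℝ)..t, tail μ y) + ∫ y in Set.Ioi t, tail μ y = ∫ y in Set.Ioi 0, tail μ y :=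
  intervalIntegral.integral_interval_add_Ioi hμ.integrableOn_tail
    (hμ.integrableOn_tail.mono_set (Set.Ioi_subset_Ioi ht))

theorem tendsto_integral_Ioi (hμ : StrongSubexponential μ) :
    Tendsto (fun t => ∫ y in Set.Ioi t, tail μ y) atTop (𝓝 0) := by
  have h := (intervalIntegral_tendsto_integral_Ioi 0 hμ.integrableOn_tail tendsto_id).const_sub
    (∫ y in Set.Ioi 0, tail μ y)
  rw [sub_self] at h
  refine h.congr' ?_
  filter_upwards [eventually_ge_atTop 0] with t ht
  rw [← hμ.intervalIntegral_add_integral_Ioi ht]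
  simp

theorem integral_Ioi_pos [IsFiniteMeasure μ] (hμ : StrongSubexponential μ) {t : ℝ} (ht : 0 ≤ t) :
    0 < ∫ y in Set.Ioi t, tail μ y := by
  rw [setIntegral_pos_iff_support_of_nonneg_ae
    (Eventually.of_forall fun y => tail_nonneg μ y)
    (hμ.integrableOn_tail.mono_set (Set.Ioi_subset_Ioi ht))]
  have : Function.support (tail μ) = Set.univ := by
    ext y; simp [(hμ.tail_pos y).ne']
  simp [this]

/-- The substitution `y ↦ x - y` folds the convolution integral at `x / 2`. -/
theorem integral_conv_eq [IsFiniteMeasure μ] (x a : ℝ) :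
    ∫ y in (x - a)..x, tail μ (x - y) * tail μ y = ∫ y in (0 : ℝ)..a, tail μ (x - y) * tail μ y := by
  have := intervalIntegral.integral_comp_sub_left (a := 0) (b := a)
    (fun y => tail μ (x - y) * tail μ y) x
  rw [sub_zero] at this
  rw [← this]
  simp [mul_comm]

/-- Discarding the middle of the convolution integral is the only loss in passing to the limit. -/
theorem eventually_integral_mid_le [IsFiniteMeasure μ] (hμ : StrongSubexponential μ) {M : ℝ}
    (hM : 0 ≤ M) {ε : ℝ} (hε : 2 * ∫ y in Set.Ioi M, tail μ y < ε) :
    ∀ᶠ x in atTop, ∫ y in M..(x - M), tail μ (x - y) * tail μ y ≤ ε * tail μ x := by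
  have hlt : 2 * (∫ y in Set.Ioi (0 : ℝ), tail μ y) < ε + 2 * ∫ y in (0 : ℝ)..M, tail μ y := by
    rw [← hμ.intervalIntegral_add_integral_Ioi hM]; linarith
  have h := hμ.tendsto_conv.eventually (gt_mem_nhds hlt)
  filter_upwards [h, eventually_ge_atTop M] with x hx hxM
  have hp := hμ.tail_pos x
  rw [div_lt_iff₀ hp] at hx
  have i := intervalIntegrable_tail_mul_tail μ x
  have e1 := intervalIntegral.integral_add_adjacent_intervals (i 0 M) (i M (x - M))
  have e2 := intervalIntegral.integral_add_adjacent_intervals (i 0 (x - M)) (i (x - M) x)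
  rw [integral_conv_eq] at e2
  have e3 : tail μ x * ∫ y in (0 : ℝ)..M, tail μ y ≤
      ∫ y in (0 : ℝ)..M, tail μ (x - y) * tail μ y := by
    rw [← intervalIntegral.integral_const_mul]
    refine intervalIntegral.integral_mono_on hM
      ((tail_antitone μ).intervalIntegrable.const_mul _) (i 0 M) fun y hy => ?_
    exact mul_le_mul_of_nonneg_right (tail_antitone μ (by linarith [hy.1])) (tail_nonneg _ _)
  linarith

/-- Strong subexponential distributions are long-tailed: the part `[t, x / 2]` of the convolution
integral, on which `tail μ (x - y) ≥ tail μ (x - t)`, leaves no room for a larger ratio. -/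
theorem tendsto_tail_sub_div [IsFiniteMeasure μ] (hμ : StrongSubexponential μ) {t : ℝ}
    (ht : 0 ≤ t) : Tendsto (fun x => tail μ (x - t) / tail μ x) atTop (𝓝 1) := by
  have hhalf : Tendsto (fun x : ℝ => x / 2) atTop atTop := tendsto_id.atTop_div_const two_pos
  have hIt := hμ.integral_Ioi_pos ht
  have hint : Tendsto (fun x : ℝ => ∫ y in t..(x / 2), tail μ y) atTop
      (𝓝 (∫ y in Set.Ioi t, tail μ y)) :=
    intervalIntegral_tendsto_integral_Ioi t
      (hμ.integrableOn_tail.mono_set (Set.Ioi_subset_Ioi ht)) hhalf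
  have hup := (((hμ.tendsto_conv.div_const 2).sub_const (∫ y in (0 : ℝ)..t, tail μ y))).div
    hint hIt.ne'
  have hlim : (2 * (∫ y in Set.Ioi 0, tail μ y) / 2 - ∫ y in (0 : ℝ)..t, tail μ y) /
      (∫ y in Set.Ioi t, tail μ y) = 1 := by
    rw [← hμ.intervalIntegral_add_integral_Ioi ht, div_eq_one_iff_eq hIt.ne']
    ring
  rw [hlim] at hup
  refine tendsto_of_tendsto_of_tendsto_of_le_of_le' tendsto_const_nhds hup
    (Eventually.of_forall fun x => ?_) ?_
  · rw [one_le_div (hμ.tail_pos x)]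
    exact tail_antitone μ (by linarith)
  filter_upwards [hint.eventually (lt_mem_nhds hIt), eventually_ge_atTop (2 * t)] with x hx hxt
  have hp := hμ.tail_pos x
  simp only [Pi.div_apply]
  rw [le_div_iff₀ hx]
  have i := intervalIntegrable_tail_mul_tail μ x
  have e1 := intervalIntegral.integral_add_adjacent_intervals (i 0 t) (i t (x / 2))
  have e2 := intervalIntegral.integral_add_adjacent_intervals (i 0 (x / 2)) (i (x / 2) x)
  have e0 := integral_conv_eq (μ := μ) x (x / 2)
  rw [show x - x / 2 = x / 2 by ring] at e0
  rw [e0] at e2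
  have e3 : tail μ x * ∫ y in (0 : ℝ)..t, tail μ y ≤
      ∫ y in (0 : ℝ)..t, tail μ (x - y) * tail μ y := by
    rw [← intervalIntegral.integral_const_mul]
    refine intervalIntegral.integral_mono_on ht
      ((tail_antitone μ).intervalIntegrable.const_mul _) (i 0 t) fun y hy => ?_
    exact mul_le_mul_of_nonneg_right (tail_antitone μ (by linarith [hy.1])) (tail_nonneg _ _)
  have e4 : tail μ (x - t) * ∫ y in t..(x / 2), tail μ y ≤
      ∫ y in t..(x / 2), tail μ (x - y) * tail μ y := by
    rw [← intervalIntegral.integral_const_mul]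
    refine intervalIntegral.integral_mono_on (by linarith)
      ((tail_antitone μ).intervalIntegrable.const_mul _) (i t (x / 2)) fun y hy => ?_
    exact mul_le_mul_of_nonneg_right (tail_antitone μ (by linarith [hy.1])) (tail_nonneg _ _)
  rw [← e2, ← e1, div_mul_eq_mul_div, div_le_iff₀ hp]
  field_simp
  linarith

/-- The ratio of a shifted tail to the tail tends to one, along the natural numbers. -/
theorem tendsto_tail_add_div [IsFiniteMeasure μ] (hμ : StrongSubexponential μ) (t : ℝ) :
    Tendsto (fun n : ℕ => tail μ (t + n) / tail μ n) atTop (𝓝 1) := by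
  rcases le_total t 0 with ht | ht
  · have := (hμ.tendsto_tail_sub_div (neg_nonneg.2 ht)).comp tendsto_natCast_atTop_atTop
    refine this.congr fun n => ?_
    simp [add_comm]
  · have h : Tendsto (fun n : ℕ => t + (n : ℝ)) atTop atTop :=
      tendsto_atTop_add_const_left _ _ tendsto_natCast_atTop_atTop
    have := ((hμ.tendsto_tail_sub_div ht).comp h).inv₀ one_ne_zero
    rw [inv_one] at this
    refine this.congr fun n => ?_
    simp

/-- The integer tails of a strong subexponential distribution form a subexponential sequence: the
middle part of the discrete convolution is dominated by the integral over the middle part. -/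
theorem subexponentialSeq [IsFiniteMeasure μ] (hμ : StrongSubexponential μ) :
    SubexponentialSeq fun n : ℕ => tail μ n where
  pos n := hμ.tail_pos n
  long := by
    have := (hμ.tendsto_tail_sub_div zero_le_one).comp
      (tendsto_natCast_atTop_atTop.comp (tendsto_add_atTop_nat 1))
    refine this.congr fun n => ?_
    simp
  tight ε hε := by
    have h := (hμ.tendsto_integral_Ioi.comp tendsto_natCast_atTop_atTop).eventually
      (gt_mem_nhds (show 0 < ε / 4 by linarith))
    filter_upwards [h] with M hM
    simp only [Function.comp] at hM
    have h2 := (tendsto_natCast_atTop_atTop (R := ℝ)).eventually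
      (hμ.eventually_integral_mid_le (ε := ε / 2) (Nat.cast_nonneg M) (by linarith))
    have h3 := ((hμ.tendsto_tail_sub_div zero_le_one).comp
      (tendsto_natCast_atTop_atTop.comp (tendsto_add_atTop_nat 1))).eventually
      (gt_mem_nhds one_lt_two)
    rw [← map_add_atTop_eq_nat 1, eventually_map]
    filter_upwards [h2, h3, eventually_ge_atTop (2 * M)] with n hn hn2 hnM
    simp only [Function.comp, Nat.cast_add, Nat.cast_one, add_sub_cancel_right] at hn2
    have hp : 0 < tail μ ((n + 1 : ℕ) : ℝ) := hμ.tail_pos _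
    push_cast at hp ⊢
    rw [div_lt_iff₀ hp] at hn2
    have e1 : ∑ ij ∈ antidiagonal (n + 1) with M < ij.1 ∧ M < ij.2, tail μ ij.1 * tail μ ij.2 =
        ∑ i ∈ Finset.Ico M (n - M), tail μ ((i + 1 : ℕ) : ℝ) * tail μ ((n - i : ℕ) : ℝ) := by
      refine Finset.sum_nbij' (fun ij => ij.1 - 1) (fun i => (i + 1, n - i)) ?_ ?_ ?_ ?_ ?_
      · simp only [Finset.mem_filter, mem_antidiagonal, Finset.mem_Ico]; intros; omega
      · simp only [Finset.mem_filter, mem_antidiagonal, Finset.mem_Ico]; intros; omega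
      · rintro ⟨i, j⟩ hij
        simp only [Finset.mem_filter, mem_antidiagonal] at hij
        exact Prod.ext (by simp only; omega) (by simp only; omega)
      · simp
      · rintro ⟨i, j⟩ hij
        simp only [Finset.mem_filter, mem_antidiagonal] at hij
        simp only
        congr 3 <;> omega
    rw [e1]
    have e2 := intervalIntegral.sum_integral_adjacent_intervals_Ico (μ := volume)
      (f := fun y => tail μ (n - y) * tail μ y) (a := fun i : ℕ => (i : ℝ)) (m := M) (n := n - M)
      (by omega) fun k _ => intervalIntegrable_tail_mul_tail μ _ _ _
    rw [Nat.cast_sub (by omega)] at e2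
    calc _ ≤ ∑ i ∈ Finset.Ico M (n - M),
          ∫ y in ((i : ℕ) : ℝ)..((i + 1 : ℕ) : ℝ), tail μ (n - y) * tail μ y := by
          refine Finset.sum_le_sum fun i hi => ?_
          rw [Finset.mem_Ico] at hi
          have := intervalIntegral.integral_mono_on (a := (i : ℝ)) (b := ((i + 1 : ℕ) : ℝ))
            (f := fun _ => tail μ ((i + 1 : ℕ) : ℝ) * tail μ ((n - i : ℕ) : ℝ))
            (μ := volume) (by simp) intervalIntegrable_const
            (intervalIntegrable_tail_mul_tail μ n _ _) fun y hy => by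
              rw [mul_comm]
              refine mul_le_mul (tail_antitone μ ?_) (tail_antitone μ hy.2) (tail_nonneg _ _)
                (tail_nonneg _ _)
              rw [Nat.cast_sub (by omega)]
              linarith [hy.1]
          simpa using this
      _ ≤ ε / 2 * tail μ n := by rw [e2]; exact hn
      _ ≤ ε * tail μ (n + 1) := by nlinarith

theorem summable_tail_add [IsFiniteMeasure μ] (hμ : StrongSubexponential μ) (t : ℝ) :
    Summable fun n : ℕ => tail μ (t + n) := by
  have h0 : Summable fun n : ℕ => tail μ (n : ℝ) := by
    rw [← summable_nat_add_iff 1]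
    refine summable_of_sum_range_le (c := ∫ y in Set.Ioi 0, tail μ y)
      (fun n => tail_nonneg _ _) fun n => ?_
    have := (tail_antitone μ).antitoneOn (Set.Icc (0 : ℝ) (0 + n)) |>.sum_le_integral
    rw [← hμ.intervalIntegral_add_integral_Ioi (Nat.cast_nonneg n)]
    have h2 := hμ.integral_Ioi_pos (Nat.cast_nonneg n)
    simp only [zero_add] at this
    linarith
  refine summable_of_isBigO_nat h0 ?_
  refine (isEquivalent_of_tendsto_one ?_).isBigO
  exact hμ.tendsto_tail_add_div t

end StrongSubexponential

/-! ### Renewal epochs of an innovation path -/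

/-- The innovation paths `s` for which `n` is a renewal epoch: the first `n` innovations alone do
not keep the chain above `x₀` at time `n`, that is, `s i - (n - 1 - i) ≤ x₀` for all `i < n`. The
starting point plays no role here. -/
def renewalAt (x₀ : ℝ) (n : ℕ) : Set (ℕ → ℝ) :=
  {s | ∀ i < n, s i + i + 1 ≤ x₀ + n}

/-- The innovation paths without a renewal epoch in `(m, n]`. -/
def noRenewal (x₀ : ℝ) (m n : ℕ) : Set (ℕ → ℝ) :=
  {s | ∀ k, m < k → k ≤ n → s ∉ renewalAt x₀ k}

/-- The path seen from time `j` on. -/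
def shift (j : ℕ) (s : ℕ → ℝ) : ℕ → ℝ := fun i => s (j + i)

theorem mem_renewalAt_zero (x₀ : ℝ) (s : ℕ → ℝ) : s ∈ renewalAt x₀ 0 := by
  simp [renewalAt]

/-- The regeneration property: after a renewal epoch `j`, the later ones are those of the shifted
path. -/
theorem shift_mem_renewalAt_iff {x₀ : ℝ} {j k : ℕ} (hjk : j ≤ k) {s : ℕ → ℝ}
    (hs : s ∈ renewalAt x₀ j) : shift j s ∈ renewalAt x₀ (k - j) ↔ s ∈ renewalAt x₀ k := by
  simp only [renewalAt, shift, Set.mem_ofPred_eq] at hs ⊢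
  have hjk' : (j : ℝ) ≤ k := by exact_mod_cast hjk
  constructor
  · intro h i hi
    rcases lt_or_ge i j with hij | hij
    · linarith [hs i hij]
    · have := h (i - j) (by omega)
      rw [Nat.add_sub_cancel' hij, Nat.cast_sub hij, Nat.cast_sub hjk] at this
      linarith
  · intro h i hi
    have := h (j + i) (by omega)
    rw [Nat.cast_sub hjk]
    push_cast at this
    linarith

theorem renewalAt_inter_shift_preimage (x₀ : ℝ) {j n : ℕ} (hjn : j ≤ n) :
    renewalAt x₀ j ∩ shift j ⁻¹' noRenewal x₀ 0 (n - j) =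
      renewalAt x₀ j ∩ noRenewal x₀ j n := by
  ext s
  refine and_congr_right fun hs => ?_
  simp only [noRenewal, Set.mem_preimage, Set.mem_ofPred_eq]
  constructor
  · intro h k hjk hkn hk
    exact h (k - j) (by omega) (by omega) ((shift_mem_renewalAt_iff hjk.le hs).2 hk)
  · intro h k hk hkn hks
    refine h (j + k) (by omega) (by omega) ((shift_mem_renewalAt_iff (by omega) hs).1 ?_)
    rwa [Nat.add_sub_cancel_left]

/-- Decomposition at the last renewal epoch up to time `n`. -/
theorem noRenewal_eq_biUnion (x₀ : ℝ) (m n : ℕ) :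
    noRenewal x₀ m n =
      ⋃ j ∈ Finset.range (min m n + 1), renewalAt x₀ j ∩ noRenewal x₀ j n := by
  classical
  ext s
  simp only [Set.mem_iUnion, Finset.mem_range, exists_prop]
  constructor
  · intro hs
    set j := Nat.findGreatest (fun j => s ∈ renewalAt x₀ j) n
    have hj : s ∈ renewalAt x₀ j :=
      Nat.findGreatest_spec (P := fun j => s ∈ renewalAt x₀ j) (Nat.zero_le n)
        (mem_renewalAt_zero x₀ s)
    have hjn : j ≤ n := Nat.findGreatest_le n
    have hjm : j ≤ m := by
      by_contra! h
      exact hs j h hjn hj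
    exact ⟨j, Nat.lt_succ_of_le (le_min hjm hjn), hj,
      fun k hk hkn => Nat.findGreatest_is_greatest hk hkn⟩
  · rintro ⟨j, hj, -, hs⟩ k hk hkn
    exact hs k (by omega) hkn

theorem pairwiseDisjoint_last_renewal (x₀ : ℝ) (m n : ℕ) :
    Set.PairwiseDisjoint (Finset.range (min m n + 1) : Set ℕ)
      fun j => renewalAt x₀ j ∩ noRenewal x₀ j n := by
  have key : ∀ i j, j ∈ Finset.range (min m n + 1) → i < j →
      Disjoint (renewalAt x₀ i ∩ noRenewal x₀ i n) (renewalAt x₀ j ∩ noRenewal x₀ j n) := by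
    intro i j hj hij
    rw [Set.disjoint_left]
    rintro s ⟨-, h⟩ ⟨h', -⟩
    rw [Finset.mem_range] at hj
    exact h j hij (by omega) h'
  intro i hi j hj hij
  rcases lt_or_gt_of_ne hij with h | h
  · exact key i j hj h
  · exact (key j i hi h).symm

theorem measurableSet_renewalAt (x₀ : ℝ) (n : ℕ) : MeasurableSet (renewalAt x₀ n) := by
  simp only [renewalAt, Set.ofPred_forall]
  measurability

theorem measurableSet_noRenewal (x₀ : ℝ) (m n : ℕ) : MeasurableSet (noRenewal x₀ m n) := by
  simp only [noRenewal, Set.ofPred_forall]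
  exact .iInter fun k => .iInter fun _ => .iInter fun _ => (measurableSet_renewalAt x₀ k).compl

theorem measurable_shift (j : ℕ) : Measurable (shift j) :=
  measurable_pi_iff.2 fun i => measurable_pi_apply (j + i)

section Law

variable (μ : Measure ℝ) [IsProbabilityMeasure μ]

theorem iIndepFun_eval :
    iIndepFun (fun (i : ℕ) (s : ℕ → ℝ) => s i) (Measure.infinitePi fun _ : ℕ => μ) :=
  iIndepFun_infinitePi (P := fun _ : ℕ => μ) (X := fun _ x => x) fun _ => measurable_id

theorem map_shift (j : ℕ) :
    (Measure.infinitePi fun _ : ℕ => μ).map (shift j) = Measure.infinitePi fun _ : ℕ => μ := by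
  have h := ((iIndepFun_eval μ).precomp (add_right_injective j)).map_fun_eq_infinitePi_map
    fun i => measurable_pi_apply (j + i)
  have h2 : ∀ i, (Measure.infinitePi fun _ : ℕ => μ).map (fun s : ℕ → ℝ => s i) = μ :=
    fun i => Measure.infinitePi_map_eval _ i
  simp only [h2] at h
  exact h

theorem measureReal_renewalAt (x₀ : ℝ) (n : ℕ) :
    (Measure.infinitePi fun _ : ℕ => μ).real (renewalAt x₀ n) =
      ∏ k ∈ Finset.range n, μ.real (Set.Iic (x₀ + k)) := by
  have h2 : ∀ i, (Measure.infinitePi fun _ : ℕ => μ).map (fun s : ℕ → ℝ => s i) = μ :=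
    fun i => Measure.infinitePi_map_eval _ i
  have h := (iIndepFun_eval μ).meas_biInter (S := Finset.range n)
    (s := fun i => (fun s : ℕ → ℝ => s i) ⁻¹' Set.Iic (x₀ + n - i - 1))
    fun i _ => ⟨_, measurableSet_Iic, rfl⟩
  have e : renewalAt x₀ n =
      ⋂ i ∈ Finset.range n, (fun s : ℕ → ℝ => s i) ⁻¹' Set.Iic (x₀ + n - i - 1) := by
    ext s
    simp only [renewalAt, Set.mem_ofPred_eq, Set.mem_iInter, Finset.mem_range, Set.mem_preimage,
      Set.mem_Iic]
    refine forall₂_congr fun i _ => ?_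
    constructor <;> intro h <;> linarith
  rw [e, measureReal_def, h, ENNReal.toReal_prod, ← Finset.prod_range_reflect]
  refine Finset.prod_congr rfl fun k hk => ?_
  rw [Finset.mem_range] at hk
  rw [← Measure.map_apply (measurable_pi_apply _) measurableSet_Iic, h2, ← measureReal_def]
  congr 2
  rw [Nat.sub_sub, Nat.cast_sub (by omega)]
  push_cast
  ring

theorem measureReal_renewalAt_inter_shift (x₀ : ℝ) (j : ℕ) {B : Set (ℕ → ℝ)}
    (hB : MeasurableSet B) :
    (Measure.infinitePi fun _ : ℕ => μ).real (renewalAt x₀ j ∩ shift j ⁻¹' B) =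
      (Measure.infinitePi fun _ : ℕ => μ).real (renewalAt x₀ j) *
        (Measure.infinitePi fun _ : ℕ => μ).real B := by
  set ν := Measure.infinitePi fun _ : ℕ => μ
  let σ : ℕ → MeasurableSpace (ℕ → ℝ) := fun i =>
    MeasurableSpace.comap (fun s : ℕ → ℝ => s i) inferInstance
  have hind : Indep (⨆ i ∈ Set.Iio j, σ i) (⨆ i ∈ Set.Ici j, σ i) ν :=
    indep_iSup_of_disjoint (m := σ) (fun i => (measurable_pi_apply i).comap_le) (iIndepFun_eval μ)
      (Set.Iio_disjoint_Ici le_rfl)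
  have h1 : MeasurableSet[⨆ i ∈ Set.Iio j, σ i] (renewalAt x₀ j) := by
    have e : renewalAt x₀ j =
        ⋂ i, ⋂ _ : i < j, (fun s : ℕ → ℝ => s i) ⁻¹' {y | y + i + 1 ≤ x₀ + j} := by
      ext s; simp [renewalAt]
    rw [e]
    refine .iInter fun i => .iInter fun hi => ?_
    have hle : σ i ≤ ⨆ i ∈ Set.Iio j, σ i := le_iSup₂_of_le i hi le_rfl
    exact hle _ ⟨_, measurableSet_le (by fun_prop) (by fun_prop), rfl⟩
  have h2 : Measurable[⨆ i ∈ Set.Ici j, σ i] (shift j) := by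
    refine @measurable_pi_lambda _ _ _ (_) _ _ fun i => ?_
    have hle : σ (j + i) ≤ ⨆ i ∈ Set.Ici j, σ i :=
      le_iSup₂_of_le (j + i) (Set.mem_Ici.2 (Nat.le_add_right j i)) le_rfl
    exact (comap_measurable fun s : ℕ → ℝ => s (j + i)).mono hle le_rfl
  have h := (Indep_iff _ _ ν).1 hind _ _ h1 (h2 hB)
  rw [measureReal_def, h, ENNReal.toReal_mul]
  congr 1
  rw [← Measure.map_apply (measurable_shift j) hB, map_shift]
  rfl

theorem measureReal_noRenewal (x₀ : ℝ) (m n : ℕ) :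
    (Measure.infinitePi fun _ : ℕ => μ).real (noRenewal x₀ m n) =
      ∑ j ∈ Finset.range (min m n + 1), (∏ k ∈ Finset.range j, μ.real (Set.Iic (x₀ + k))) *
        (Measure.infinitePi fun _ : ℕ => μ).real (noRenewal x₀ 0 (n - j)) := by
  rw [noRenewal_eq_biUnion, measureReal_biUnion_finset (pairwiseDisjoint_last_renewal x₀ m n)
    fun j _ => (measurableSet_renewalAt x₀ j).inter (measurableSet_noRenewal x₀ j n)]
  refine Finset.sum_congr rfl fun j hj => ?_
  rw [Finset.mem_range] at hj
  rw [← renewalAt_inter_shift_preimage x₀ (by omega),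
    measureReal_renewalAt_inter_shift μ x₀ j (measurableSet_noRenewal _ _ _),
    measureReal_renewalAt]

end Law

/-! ### The chain and its recurrence time -/

variable {Ω : Type*}

/-- The chain is the maximum of its starting point and of the innovations, each lowered by the
time elapsed since. -/
theorem chain_le_iff (η : ℕ → Ω → ℝ) (x : ℝ) (n : ℕ) (ω : Ω) (y : ℝ) :
    chain η x n ω ≤ y ↔ x ≤ y + n ∧ (fun i => η i ω) ∈ renewalAt y n := by
  induction n generalizing y with
  | zero => simp [chain, mem_renewalAt_zero]
  | succ n ih =>
    have h : chain η x (n + 1) ω ≤ y ↔ chain η x n ω ≤ y + 1 ∧ η n ω ≤ y := by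
      rw [chain, max_le_iff, sub_le_iff_le_add]
    rw [h, ih, and_assoc]
    refine and_congr (by push_cast; constructor <;> intro h <;> linarith) ?_
    simp only [renewalAt, Set.mem_ofPred_eq]
    push_cast
    constructor
    · rintro ⟨h1, h2⟩ i hi
      rcases Nat.lt_succ_iff_lt_or_eq.1 hi with hi | rfl
      · linarith [h1 i hi]
      · linarith
    · intro h
      exact ⟨fun i hi => by linarith [h i (by omega)], by linarith [h n (by omega)]⟩

/-- Started in `(x₀ + m, x₀ + m + 1]`, the chain first recurs at the first renewal epoch
exceeding `m`. -/
theorem lt_recTime_iff (η : ℕ → Ω → ℝ) {x₀ x : ℝ} {m : ℕ}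
    (hx : x ∈ Set.Ioc (x₀ + m) (x₀ + m + 1)) (n : ℕ) (ω : Ω) :
    (n : ℕ∞) < recTime η x₀ x ω ↔ (fun i => η i ω) ∈ noRenewal x₀ m n := by
  rw [← ENat.add_one_le_iff (ENat.natCast_ne_top n), recTime, le_iInf₂_iff]
  simp only [noRenewal, Set.mem_ofPred_eq, chain_le_iff]
  refine forall_congr' fun k => ?_
  have hk : x ≤ x₀ + k ↔ m < k := by
    constructor
    · intro h
      have : (m : ℝ) < k := by linarith [hx.1]
      exact_mod_cast this
    · intro h
      have : (m : ℝ) + 1 ≤ k := by exact_mod_cast h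
      linarith [hx.2]
  rw [hk]
  norm_cast
  constructor
  · intro h h1 h2 h3
    have := h ⟨by omega, h1, h3⟩
    omega
  · rintro h ⟨-, h1, h2⟩
    by_contra! h3
    exact h h1 (by omega) h2

theorem exists_mem_Ioc_of_lt {x₀ x : ℝ} (hx : x₀ < x) :
    ∃ m : ℕ, x ∈ Set.Ioc (x₀ + m) (x₀ + m + 1) := by
  have h0 : 0 < ⌈x - x₀⌉₊ := Nat.ceil_pos.2 (sub_pos.2 hx)
  obtain ⟨m, hm⟩ : ∃ m, ⌈x - x₀⌉₊ = m + 1 := ⟨⌈x - x₀⌉₊ - 1, by omega⟩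
  obtain ⟨h1, h2⟩ := (Nat.ceil_eq_iff (Nat.succ_ne_zero m)).1 hm
  push_cast at h1 h2
  exact ⟨m, by linarith, by linarith⟩

theorem _root_.ENat.toENNReal_eq_tsum_indicator (t : ℕ∞) :
    (t : ℝ≥0∞) = ∑' n : ℕ, {n : ℕ | (n : ℕ∞) < t}.indicator 1 n := by
  induction t using ENat.recTopCoe with
  | top => simp
  | coe t =>
    have h1 : ∀ n ∈ Finset.range t, {n : ℕ | (n : ℕ∞) < t}.indicator (1 : ℕ → ℝ≥0∞) n = 1 :=
      fun n hn => Set.indicator_of_mem (s := {n : ℕ | (n : ℕ∞) < t})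
        (by simpa using hn) _
    rw [tsum_eq_sum (s := Finset.range t) fun n hn => by simpa using hn, Finset.sum_congr rfl h1]
    simp

theorem measureReal_lt_recTime [MeasurableSpace Ω] {P : Measure Ω} {η : ℕ → Ω → ℝ}
    (hmeas : ∀ n, Measurable (η n)) (hindep : iIndepFun η P)
    (hident : ∀ n, IdentDistrib (η n) (η 0) P P) {x₀ x : ℝ} {m : ℕ}
    (hx : x ∈ Set.Ioc (x₀ + m) (x₀ + m + 1))
    (n : ℕ) : P.real {ω | (n : ℕ∞) < recTime η x₀ x ω} =
      (Measure.infinitePi fun _ : ℕ => P.map (η 0)).real (noRenewal x₀ m n) := by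
  have h := hindep.map_fun_eq_infinitePi_map hmeas
  simp only [fun i => (hident i).map_eq] at h
  rw [← h, map_measureReal_apply (measurable_pi_iff.2 hmeas) (measurableSet_noRenewal x₀ m n)]
  congr 1
  ext ω
  exact lt_recTime_iff η hx n ω

theorem meanRecTime_eq_tsum [MeasurableSpace Ω] {P : Measure Ω} [IsFiniteMeasure P]
    {η : ℕ → Ω → ℝ} (hmeas : ∀ n, Measurable (η n)) {x₀ x : ℝ} (hx : x₀ < x) :
    meanRecTime P η x₀ x =
      ∑' n : ℕ, ENNReal.ofReal (P.real {ω | (n : ℕ∞) < recTime η x₀ x ω}) := by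
  obtain ⟨m, hm⟩ := exists_mem_Ioc_of_lt hx
  have hms : ∀ n : ℕ, MeasurableSet {ω | (n : ℕ∞) < recTime η x₀ x ω} := fun n => by
    simp only [lt_recTime_iff η hm]
    exact measurable_pi_iff.2 hmeas (measurableSet_noRenewal x₀ m n)
  simp only [meanRecTime]
  calc _ = ∫⁻ ω, ∑' n : ℕ, {ω | (n : ℕ∞) < recTime η x₀ x ω}.indicator 1 ω ∂P :=
        lintegral_congr fun ω => ENat.toENNReal_eq_tsum_indicator _
    _ = ∑' n : ℕ, ∫⁻ ω, {ω | (n : ℕ∞) < recTime η x₀ x ω}.indicator 1 ω ∂P :=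
        lintegral_tsum fun n => (measurable_one.indicator (hms n)).aemeasurable
    _ = _ := tsum_congr fun n => by
        rw [lintegral_indicator_one (hms n), ofReal_measureReal (measure_ne_top P _)]

/-! ### Convolution inverses of renewal sequences -/

/-- The elementary renewal theorem for the convolution inverse `q` of a renewal sequence `u` whose
limit `L` is positive: the gap tails `q` sum to the mean gap `1 / L`. -/
theorem hasSum_of_renewal_identity {u q : ℕ → ℝ} {L : ℝ} (hL : 0 < L) (huL : ∀ n, L ≤ u n)
    (hu1 : ∀ n, u n ≤ 1) (hu : Tendsto u atTop (𝓝 L)) (hq0 : ∀ n, 0 ≤ q n)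
    (h : ∀ n, ∑ j ∈ Finset.range (n + 1), u j * q (n - j) = 1) : HasSum q (1 / L) := by
  have h' : ∀ n, ∑ k ∈ Finset.range (n + 1), u (n - k) * q k = 1 := fun n => by
    rw [← h n, ← Finset.sum_range_reflect]
    refine Finset.sum_congr rfl fun k hk => ?_
    rw [Finset.mem_range] at hk
    congr 2
    omega
  have hs : Summable q := by
    refine summable_of_sum_range_le (c := 1 / L) hq0 fun n => ?_
    rw [le_div_iff₀ hL, ← h' n, Finset.sum_mul]
    calc _ ≤ ∑ k ∈ Finset.range n, u (n - k) * q k :=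
          Finset.sum_le_sum fun k _ => by
            rw [mul_comm]; exact mul_le_mul_of_nonneg_right (huL _) (hq0 k)
      _ ≤ _ := Finset.sum_le_sum_of_subset_of_nonneg
          (Finset.range_subset_range.2 (Nat.le_succ n)) fun k _ _ =>
            mul_nonneg (hL.le.trans (huL _)) (hq0 k)
  have hlim : Tendsto (fun n => ∑' k, if k ≤ n then u (n - k) * q k else 0) atTop
      (𝓝 (∑' k, L * q k)) := by
    refine tendsto_tsum_of_dominated_convergence hs (fun k => ?_)
      (Eventually.of_forall fun n k => ?_)
    · have := (hu.comp (tendsto_sub_atTop_nat k)).mul_const (q k)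
      refine this.congr' ?_
      filter_upwards [eventually_ge_atTop k] with n hn
      simp [hn]
    · split_ifs
      · rw [Real.norm_of_nonneg (mul_nonneg (hL.le.trans (huL _)) (hq0 k))]
        exact mul_le_of_le_one_left (hq0 k) (hu1 _)
      · simpa using hq0 k
  have hone : (fun n => ∑' k, if k ≤ n then u (n - k) * q k else 0) = fun _ => 1 := by
    ext n
    rw [tsum_eq_sum (s := Finset.range (n + 1)) fun k hk => by
      rw [Finset.mem_range] at hk; exact if_neg (by omega), ← h' n]
    refine Finset.sum_congr rfl fun k hk => ?_
    rw [Finset.mem_range] at hk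
    exact if_pos (by omega)
  rw [hone, tendsto_const_nhds_iff, tsum_mul_left] at hlim
  rw [show 1 / L = ∑' k, q k by rw [hlim]; field_simp]
  exact hs.hasSum

theorem hasSum_sum_mul_sub {u q : ℕ → ℝ} {Q : ℝ} (hq : HasSum q Q) (m : ℕ) :
    HasSum (fun n => ∑ j ∈ Finset.range (min m n + 1), u j * q (n - j))
      ((∑ j ∈ Finset.range (m + 1), u j) * Q) := by
  have h1 : ∀ j, HasSum (fun n => if j ≤ n then q (n - j) else 0) Q := fun j => by
    rw [← (add_left_injective j).hasSum_iff]
    · simpa [Function.comp_def] using hq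
    · intro n hn
      refine if_neg fun h => hn ⟨n - j, Nat.sub_add_cancel h⟩
  have e : ∀ n, ∑ j ∈ Finset.range (min m n + 1), u j * q (n - j) =
      ∑ j ∈ Finset.range (m + 1), u j * if j ≤ n then q (n - j) else 0 := fun n => by
    simp only [mul_ite, mul_zero]
    rw [← Finset.sum_filter]
    refine Finset.sum_congr ?_ fun _ _ => rfl
    ext j
    simp only [Finset.mem_filter, Finset.mem_range]
    omega
  simp only [e, Finset.sum_mul]
  exact hasSum_sum fun j _ => (h1 j).mul_left (u j)

/-- The renewal equation in terms of the increments of the renewal sequence. -/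
theorem renewal_equation_of_identity {u q : ℕ → ℝ} (hu0 : u 0 = 1)
    (h : ∀ n, ∑ j ∈ Finset.range (n + 1), u j * q (n - j) = 1) (n : ℕ) :
    q (n + 1) = ∑ ij ∈ antidiagonal n, (u ij.1 - u (ij.1 + 1)) * q ij.2 := by
  rw [Finset.Nat.sum_antidiagonal_eq_sum_range_succ fun i j => (u i - u (i + 1)) * q j]
  simp only [sub_mul, Finset.sum_sub_distrib]
  have h1 := h (n + 1)
  rw [Finset.sum_range_succ', hu0] at h1
  simp only [Nat.add_sub_add_right, Nat.sub_zero, one_mul] at h1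
  rw [h n]
  linarith

/-! ### The gaps between renewal epochs -/

section Product

variable {μ : Measure ℝ} [IsProbabilityMeasure μ]

theorem measureReal_Iic (y : ℝ) : μ.real (Set.Iic y) = 1 - tail μ y := by
  rw [tail, ← Set.compl_Iic, probReal_compl_eq_one_sub measurableSet_Iic]
  ring

theorem StrongSubexponential.multipliable_measureReal_Iic (hμ : StrongSubexponential μ) (x₀ : ℝ) :
    Multipliable fun k : ℕ => μ.real (Set.Iic (x₀ + k)) := by
  simp only [measureReal_Iic, sub_eq_add_neg]
  exact Real.multipliable_one_add_of_summable (hμ.summable_tail_add x₀).neg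

theorem measureReal_Iic_add_pos {x₀ : ℝ} (hx₀ : 0 < μ.real (Set.Iic x₀)) (k : ℕ) :
    0 < μ.real (Set.Iic (x₀ + k)) :=
  hx₀.trans_le (measureReal_mono (Set.Iic_subset_Iic.2 (by simp)))

theorem StrongSubexponential.tprod_measureReal_Iic_pos (hμ : StrongSubexponential μ) {x₀ : ℝ}
    (hx₀ : 0 < μ.real (Set.Iic x₀)) : 0 < ∏' k : ℕ, μ.real (Set.Iic (x₀ + k)) := by
  refine lt_of_le_of_ne (le_of_tendsto_of_tendsto' tendsto_const_nhds
    (hμ.multipliable_measureReal_Iic x₀).hasProd.tendsto_prod_nat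
    fun n => Finset.prod_nonneg fun _ _ => measureReal_nonneg) (Ne.symm ?_)
  have h := tprod_one_add_ne_zero_of_summable (f := fun k : ℕ => -tail μ (x₀ + k))
    (fun k => by
      have := measureReal_Iic_add_pos hx₀ k
      rw [measureReal_Iic] at this
      linarith) (hμ.summable_tail_add x₀).neg.norm
  simpa only [measureReal_Iic, sub_eq_add_neg] using h

/-- The gap-tail probabilities `P(no renewal in (0, n])` sum to the mean gap, and are asymptotic to
its product with the innovation tail. -/
theorem StrongSubexponential.hasSum_and_tendsto_noRenewal (hμ : StrongSubexponential μ) {x₀ : ℝ}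
    (hx₀ : 0 < μ.real (Set.Iic x₀)) :
    HasSum (fun n => (Measure.infinitePi fun _ : ℕ => μ).real (noRenewal x₀ 0 n))
      (1 / ∏' k : ℕ, μ.real (Set.Iic (x₀ + k))) ∧
    Tendsto (fun n : ℕ => (Measure.infinitePi fun _ : ℕ => μ).real (noRenewal x₀ 0 n) / tail μ n)
      atTop (𝓝 (1 / ∏' k : ℕ, μ.real (Set.Iic (x₀ + k)))) := by
  set q : ℕ → ℝ := fun n => (Measure.infinitePi fun _ : ℕ => μ).real (noRenewal x₀ 0 n) with hq
  set L := ∏' k : ℕ, μ.real (Set.Iic (x₀ + k))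
  set u : ℕ → ℝ := fun n => ∏ k ∈ Finset.range n, μ.real (Set.Iic (x₀ + k)) with hu
  have hL : 0 < L := hμ.tprod_measureReal_Iic_pos hx₀
  have huL : Tendsto u atTop (𝓝 L) :=
    (hμ.multipliable_measureReal_Iic x₀).hasProd.tendsto_prod_nat
  have hu0 : ∀ n, 0 ≤ u n := fun n => Finset.prod_nonneg fun _ _ => measureReal_nonneg
  have hdiff : ∀ n, u n - u (n + 1) = u n * tail μ (x₀ + n) := fun n => by
    simp only [hu, Finset.prod_range_succ, measureReal_Iic]
    ring
  have hw0 : ∀ n, 0 ≤ u n - u (n + 1) := fun n => by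
    rw [hdiff]; exact mul_nonneg (hu0 n) (tail_nonneg _ _)
  have hanti : Antitone u := antitone_nat_of_succ_le fun n => sub_nonneg.1 (hw0 n)
  have hu1 : ∀ n, u n ≤ 1 := fun n => by simpa [hu] using hanti (Nat.zero_le n)
  have hq0 : ∀ n, 0 ≤ q n := fun n => measureReal_nonneg
  -- No renewal in `(n, n]` is the sure event, so its last-renewal decomposition sums to one.
  have hid : ∀ n, ∑ j ∈ Finset.range (n + 1), u j * q (n - j) = 1 := fun n => by
    have h := measureReal_noRenewal μ x₀ n n
    rw [min_self] at h
    rw [← h, show noRenewal x₀ n n = Set.univ from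
      Set.eq_univ_of_forall fun s k h1 h2 => absurd h1 (not_lt.2 h2)]
    exact probReal_univ
  have hqs : HasSum q (1 / L) :=
    hasSum_of_renewal_identity hL (hanti.le_of_tendsto huL) hu1 huL hq0 hid
  have hws : HasSum (fun n => u n - u (n + 1)) (1 - L) := by
    rw [hasSum_iff_tendsto_nat_of_nonneg hw0]
    simp only [Finset.sum_range_sub']
    simpa [hu] using huL.const_sub 1
  have hw : Tendsto (fun n : ℕ => (u n - u (n + 1)) / tail μ n) atTop (𝓝 L) := by
    simp only [hdiff, mul_div_assoc]
    simpa using huL.mul (hμ.tendsto_tail_add_div x₀)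
  refine ⟨hqs, ?_⟩
  have h := hμ.subexponentialSeq.tendsto_renewal hw0 hws.summable (by rw [hws.tsum_eq]; linarith)
    hw hq0 hqs.summable (renewal_equation_of_identity (by simp [hu]) hid)
  rw [hws.tsum_eq, hqs.tsum_eq, mul_one_div_cancel hL.ne', sub_sub_cancel] at h
  exact h

end Product

/-- Both the mean and the asymptotic tail of the recurrence time are those of a gap between renewal
epochs, multiplied by the expected number of renewal epochs in `[0, m]`. -/
theorem meanRecTime_eq_and_tendsto {Ω : Type*} [MeasurableSpace Ω] {P : Measure Ω}
    [IsProbabilityMeasure P] {η : ℕ → Ω → ℝ} (hmeas : ∀ n, Measurable (η n))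
    (hindep : iIndepFun η P) (hident : ∀ n, IdentDistrib (η n) (η 0) P P)
    {x₀ : ℝ} (hx₀ : 0 < (P.map (η 0)).real (Set.Iic x₀))
    (hsub : StrongSubexponential (P.map (η 0))) {x : ℝ} {m : ℕ}
    (hx : x ∈ Set.Ioc (x₀ + m) (x₀ + m + 1)) :
    meanRecTime P η x₀ x = ENNReal.ofReal
      ((∑ j ∈ Finset.range (m + 1), ∏ k ∈ Finset.range j, (P.map (η 0)).real (Set.Iic (x₀ + k))) *
        (1 / ∏' k : ℕ, (P.map (η 0)).real (Set.Iic (x₀ + k)))) ∧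
    Tendsto (fun n : ℕ => P.real {ω | (n : ℕ∞) < recTime η x₀ x ω} / tail (P.map (η 0)) n) atTop
      (𝓝 ((∑ j ∈ Finset.range (m + 1), ∏ k ∈ Finset.range j,
        (P.map (η 0)).real (Set.Iic (x₀ + k))) *
          (1 / ∏' k : ℕ, (P.map (η 0)).real (Set.Iic (x₀ + k))))) := by
  have hprob : IsProbabilityMeasure (P.map (η 0)) :=
    Measure.isProbabilityMeasure_map (hmeas 0).aemeasurable
  obtain ⟨hs, ht⟩ := hsub.hasSum_and_tendsto_noRenewal hx₀
  have hx' : x₀ < x := by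
    have : (0 : ℝ) ≤ m := Nat.cast_nonneg m
    linarith [hx.1]
  constructor
  · have h := hasSum_sum_mul_sub
      (u := fun j => ∏ k ∈ Finset.range j, (P.map (η 0)).real (Set.Iic (x₀ + k))) hs m
    simp only [← measureReal_noRenewal] at h
    rw [meanRecTime_eq_tsum hmeas hx']
    simp only [measureReal_lt_recTime hmeas hindep hident hx]
    rw [← ENNReal.ofReal_tsum_of_nonneg (fun _ => measureReal_nonneg) h.summable, h.tsum_eq]
  · have h := hsub.subexponentialSeq.tendsto_sum_sub_div_succ ht
      (fun j => ∏ k ∈ Finset.range j, (P.map (η 0)).real (Set.Iic (x₀ + k))) (m + 1)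
    have h2 := h.div hsub.subexponentialSeq.long one_ne_zero
    rw [div_one] at h2
    refine h2.congr' ?_
    filter_upwards [eventually_ge_atTop m] with n hn
    rw [measureReal_lt_recTime hmeas hindep hident hx, measureReal_noRenewal, min_eq_left hn]
    have := (hsub.tail_pos ((n + 1 : ℕ) : ℝ)).ne'
    simp only [Pi.div_apply]
    field_simp

end RandomExchange

theorem theorem4 {Ω : Type*} [MeasurableSpace Ω] (P : Measure Ω) [IsProbabilityMeasure P]
    (η : ℕ → Ω → ℝ) (hmeas : ∀ n, Measurable (η n)) (hindep : iIndepFun η P)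
    (hident : ∀ n, IdentDistrib (η n) (η 0) P P)
    (x₀ : ℝ) (hx₀ : 0 < P.real {ω | η 0 ω ≤ x₀} * P.real {ω | x₀ < η 0 ω})
    (hmean : Integrable (fun ω => max (η 0 ω) 0) P)
    (hsub : RandomExchange.StrongSubexponential (P.map (η 0))) :
    (∀ x, x₀ < x →
      RandomExchange.meanRecTime P η x₀ x < ∞ ∧
      (fun n : ℕ => P.real {ω | (n : ℕ∞) < RandomExchange.recTime η x₀ x ω}) ~[atTop]
        (fun n : ℕ => (RandomExchange.meanRecTime P η x₀ x).toReal *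
          P.real {ω | (n : ℝ) < η 0 ω})) ∧
    Multipliable (fun k : ℕ => P.real {ω | η 0 ω ≤ x₀ + k}) ∧
    0 < ∏' k : ℕ, P.real {ω | η 0 ω ≤ x₀ + k} ∧
    (∀ (n : ℕ) (x : ℝ), x ∈ Set.Ioc (x₀ + n) (x₀ + n + 1) →
      (RandomExchange.meanRecTime P η x₀ x).toReal =
        1 / (∏' k : ℕ, P.real {ω | η 0 ω ≤ x₀ + k}) *
          (1 + ∑ j ∈ Finset.Icc 1 n, ∏ k ∈ Finset.range j, P.real {ω | η 0 ω ≤ x₀ + k})) := by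
  have hprob : IsProbabilityMeasure (P.map (η 0)) :=
    Measure.isProbabilityMeasure_map (hmeas 0).aemeasurable
  have hIic : ∀ y, P.real {ω | η 0 ω ≤ y} = (P.map (η 0)).real (Set.Iic y) := fun y =>
    (map_measureReal_apply (hmeas 0) measurableSet_Iic).symm
  have htail : ∀ y, P.real {ω | y < η 0 ω} = RandomExchange.tail (P.map (η 0)) y := fun y =>
    (map_measureReal_apply (hmeas 0) measurableSet_Ioi).symm
  simp only [hIic, htail] at hx₀ ⊢
  have hpos : 0 < (P.map (η 0)).real (Set.Iic x₀) :=
    pos_of_mul_pos_left hx₀ (RandomExchange.tail_nonneg _ _)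
  have hL := hsub.tprod_measureReal_Iic_pos hpos
  have hE : ∀ m : ℕ, 0 < (∑ j ∈ Finset.range (m + 1), ∏ k ∈ Finset.range j,
      (P.map (η 0)).real (Set.Iic (x₀ + k))) *
        (1 / ∏' k : ℕ, (P.map (η 0)).real (Set.Iic (x₀ + k))) := fun m => by
    refine mul_pos (Finset.sum_pos (fun j _ => Finset.prod_pos fun k _ => ?_) (by simp))
      (one_div_pos.2 hL)
    exact RandomExchange.measureReal_Iic_add_pos hpos k
  refine ⟨fun x hx => ?_, hsub.multipliable_measureReal_Iic x₀, hL, fun m x hx => ?_⟩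
  · obtain ⟨m, hm⟩ := RandomExchange.exists_mem_Ioc_of_lt hx
    obtain ⟨h1, h2⟩ := RandomExchange.meanRecTime_eq_and_tendsto hmeas hindep hident hpos hsub hm
    have hpos' : 0 < (RandomExchange.meanRecTime P η x₀ x).toReal := by
      rw [h1, ENNReal.toReal_ofReal (hE m).le]
      exact hE m
    rw [← ENNReal.toReal_ofReal (hE m).le, ← h1] at h2
    refine ⟨h1 ▸ ENNReal.ofReal_lt_top, ?_⟩
    have h3 := h2.div_const (RandomExchange.meanRecTime P η x₀ x).toReal
    rw [div_self hpos'.ne'] at h3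
    refine isEquivalent_of_tendsto_one (h3.congr fun n => ?_)
    rw [Pi.div_apply, div_div, mul_comm (RandomExchange.tail _ _)]
  · rw [(RandomExchange.meanRecTime_eq_and_tendsto hmeas hindep hident hpos hsub hx).1,
      ENNReal.toReal_ofReal (hE m).le, mul_comm, Finset.sum_range_succ', add_comm (Finset.sum _ _),
      Finset.prod_range_zero, Finset.range_eq_Ico,
      Finset.sum_Ico_add' (fun j => ∏ k ∈ Finset.range j, (P.map (η 0)).real (Set.Iic (x₀ + k))),
      zero_add, Finset.Ico_add_one_right_eq_Icc]
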